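/- Let $\mathcal X,\mathcal Y,\widehat{\mathcal Y}$ be measurable spaces such that singletons of $\mathcal X$ and of $\mathcal Y$ are measurable and $|\mathcal X|=\infty$ or $|\mathcal Y|=\infty$. Let $\ell:\widehat{\mathcal Y}\times\mathcal Y\to[0,B]$ be a measurable loss and $\psi(y',y'',y)=\ell(y',y)-\ell(y'',y)$. Fix $\alpha\in(0,1)$, integers $n,N\ge 1$, $q\in\{1,2\}$ and $\gamma_q\ge 2B/n^{1/q}$. **Algorithms.** A (randomized) algorithm $\mathcal A$ maps a data set $\mathcal D\in\bigcup_{m\ge 0}(\mathcal X\times\mathcal Y)^m$ and a seed $\xi\in[0,1]$ to a function $\mathcal A(\mathcal D;\xi):\mathcal X\to\widehat{\mathcal Y}$, so that for each $m$ the map $(\mathcal D,\xi,x)\mapsto[\mathcal A(\mathcal D;\xi)](x)$ is measurable on $(\mathcal X\times\mathcal Y)^m\times[0,1]\times\mathcal X$. For a probability distribution $P$ on $\mathcal X\times\mathcal Y$ let $(X_1,Y_1),\dots,(X_{n+1},Y_{n+1})$ be i.i.d. from $P$ and $\xi\sim\mathrm{Unif}[0,1]$ independent of them, and put $\mathcal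 D_n=((X_i,Y_i))_{i\in[n]}$, $\mathcal D_n^{-j}=((X_i,Y_i))_{i\in[n]\setminus\{j\}}$, $\widehat f_n=\mathcal A(\mathcal D_n;\xi)$, $\widehat f_n^{-j}=\mathcal A(\mathcal D_n^{-j};\xi)$. Define the stability $$\beta_q(\mathcal A,P,n)=\max_{1\le j\le n}\mathbb E\Big[\big|\ell(\widehat f_n(X_{n+1}),Y_{n+1})-\ell(\widehat f_n^{-j}(X_{n+1}),Y_{n+1})\big|^q\Big]^{1/q}$$ and the comparison risks $\Delta_P(f_0,f_1)=\mathbb E_P[\psi(f_0(X),f_1(X),Y)]$, $\Delta_{P,n}(\mathcal A_0,\mathcal A_1)=\mathbb E\big[\Delta_P(\mathcal A_0(\mathcal D_n;\xi),\mathcal A_1(\mathcal D_n;\xi))\big]$, and $\Delta_P^{\max}=\sup_{f_0,f_1}\Delta_P(f_0,f_1)$, the supremum being over measurable $f_0,f_1:\mathcal X\to\widehat{\mathcal Y}$. **Black-box tests.** A black-box comparison test $\widehat T$ takes algorithms $\mathcal A_0,\mathcal A_1$ and data $\mathcal D_N\in(\mathcal X\times\mathcal Y)^N$ and uses i.i.d.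 seeds $\zeta^{(1)},\zeta^{(2)},\dots,\zeta\sim\mathrm{Unif}[0,1]$, independent of $\mathcal D_N$. In round $r=1,2,\dots$ it computes a finite data set and a seed $$(\mathcal D^{(r)},\xi^{(r)})=g^{(r)}\big(\mathcal D_N,(\mathcal D^{(s)},\xi^{(s)},\widehat f_0^{(s)},\widehat f_1^{(s)},\zeta^{(s)})_{s<r},\zeta^{(r)}\big)$$ and then the fitted models $\widehat f_l^{(r)}=\mathcal A_l(\mathcal D^{(r)};\xi^{(r)})$, $l=0,1$. It stops after the first round $\widehat r\geq 1$ at which a stopping criterion, a function of $\mathcal D_N$ and of everything produced in rounds $1,\dots,\widehat r$, is met, and returns a value in $\{0,1\}$ that is a function $g$ of $\mathcal D_N$, of everything produced in these rounds, and of $\zeta$. The functions $g^{(r)}$, $g$ and the stopping criterion are arbitrary, except that, for all $\mathcal A_0,\mathcal A_1$, the output is a measurable function of $(\mathcal D_N,\zeta^{(1)},\zeta^{(2)},\dots,\zeta)$ and, for every $P$, when $\mathcal D_N$ is i.i.d. from $P$, $\widehat r<\infty$ almost surely. Write $\mathbb P_P$ for probability over $\mathcal D_N$ i.i.d. from $P$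 and the seeds. **Theorem.** Let $\widehat T$ be a black-box comparison test with $$\mathbb P_P\big(\widehat T(\mathcal A_0,\mathcal A_1,\mathcal D_N)=1\big)\le\alpha$$ for all algorithms $\mathcal A_0,\mathcal A_1$ and all $P$ such that $\beta_q(\mathcal A_l,P,n)\le\gamma_q$ for $l=0,1$ and $\Delta_{P,n}(\mathcal A_0,\mathcal A_1)\le 0$. Then for any $\mathcal A_0,\mathcal A_1$ and any $P$ with $\beta_q(\mathcal A_l,P,n)\le\gamma_q$ for $l=0,1$ and $\Delta_{P,n}(\mathcal A_0,\mathcal A_1)>0$, $$\mathbb P_P\big(\widehat T(\mathcal A_0,\mathcal A_1,\mathcal D_N)=1\big)\le\left[\alpha\left(1+\frac{\Delta_{P,n}(\mathcal A_0,\mathcal A_1)+\frac{B(\alpha^{-1}-1)}{N}}{\Delta_P^{\max}-\frac{B(\alpha^{-1}-1)}{N}}\right)^{N/n}\right]\wedge 1,$$ provided that $\Delta_P^{\max}>\frac{B(\alpha^{-1}-1)}{N}$. -/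

import Mathlib

open MeasureTheory unitInterval

/-- A data set of arbitrary finite size: a finite ordered tuple of data points. -/
abbrev DataSet (Z : Type*) : Type _ := Σ m : ℕ, (Fin m → Z)

/-- A randomized regression algorithm: it takes a data set of any size and a random seed
`ξ ∈ [0,1]`, and returns a fitted model `X → Yhat`. For each size `m` of the data set, the fitted
value is jointly measurable in the data, the seed and the feature. -/
structure Algorithm (X Y Yhat : Type*) [MeasurableSpace X] [MeasurableSpace Y]
    [MeasurableSpace Yhat] where
  /-- The fitted model. -/
  fit : DataSet (X × Y) → I → X → Yhat
  measurable_fit : ∀ m : ℕ, Measurable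
    (fun p : (Fin m → X × Y) × I × X => fit ⟨m, p.1⟩ p.2.1 p.2.2)

/-- The data set with the `j`-th data point removed. -/
def deletePoint {Z : Type*} : {n : ℕ} → (Fin n → Z) → Fin n → DataSet Z
  | 0, _, j => j.elim0
  | n + 1, D, j => ⟨n, j.removeNth D⟩

/-- The comparison function given by the difference in losses. -/
def lossDifference {Y Yhat : Type*} (ℓ : Yhat → Y → ℝ) : Yhat → Yhat → Y → ℝ :=
  fun y' y'' y => ℓ y' y - ℓ y'' y

/-- The law of a sample of `n` i.i.d. points from `P`, with an independent uniform seed. -/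
noncomputable def trainingLaw {Z : Type*} [MeasurableSpace Z] (P : Measure Z) (n : ℕ) :
    Measure ((Fin n → Z) × I) :=
  (Measure.pi (fun _ : Fin n => P)).prod volume

/-- The comparison risk `Δ_P(f₀, f₁) = E_P[ψ(f₀(X), f₁(X), Y)]` of two models. -/
noncomputable def modelDelta {X Y Yhat : Type*} [MeasurableSpace X] [MeasurableSpace Y]
    (ψ : Yhat → Yhat → Y → ℝ) (P : Measure (X × Y)) (f₀ f₁ : X → Yhat) : ℝ :=
  ∫ z, ψ (f₀ z.1) (f₁ z.1) z.2 ∂P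

/-- The comparison risk `Δ_{P,n}(A₀, A₁)` of two algorithms, trained on the same `n` i.i.d.
points from `P` with the same seed. -/
noncomputable def algDelta {X Y Yhat : Type*} [MeasurableSpace X] [MeasurableSpace Y]
    [MeasurableSpace Yhat] (ψ : Yhat → Yhat → Y → ℝ) (P : Measure (X × Y)) (n : ℕ)
    (A₀ A₁ : Algorithm X Y Yhat) : ℝ :=
  ∫ ω, modelDelta ψ P (A₀.fit ⟨n, ω.1⟩ ω.2) (A₁.fit ⟨n, ω.1⟩ ω.2) ∂(trainingLaw P n)

/-- `Δ_P^max`: the supremum of `Δ_P(f₀, f₁)` over all pairs of (measurable) models. -/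
noncomputable def deltaMax {X Y Yhat : Type*} [MeasurableSpace X] [MeasurableSpace Y]
    [MeasurableSpace Yhat] (ψ : Yhat → Yhat → Y → ℝ) (P : Measure (X × Y)) : ℝ :=
  sSup {d : ℝ | ∃ f₀ f₁ : X → Yhat, Measurable f₀ ∧ Measurable f₁ ∧ d = modelDelta ψ P f₀ f₁}

/-- The `ℓ_q`-stability `β_q(A, P, n)` of an algorithm with respect to the loss `ℓ`: the maximum
over `j` of the `L^q` norm of the change in loss at an independent test point when the `j`-th
training point is removed (the seed is kept). -/
noncomputable def stability {X Y Yhat : Type*} [MeasurableSpace X] [MeasurableSpace Y]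
    [MeasurableSpace Yhat] (ℓ : Yhat → Y → ℝ) (q : ℕ) (A : Algorithm X Y Yhat)
    (P : Measure (X × Y)) (n : ℕ) : ℝ :=
  ⨆ j : Fin n,
    (∫ ω, |ℓ (A.fit ⟨n, ω.1.1⟩ ω.1.2 ω.2.1) ω.2.2
          - ℓ (A.fit (deletePoint ω.1.1 j) ω.1.2 ω.2.1) ω.2.2| ^ q
      ∂((trainingLaw P n).prod P)) ^ (1 / (q : ℝ))

/-- What a comparison procedure has seen in one round: the data set `D⁽ʳ⁾`, the algorithm
seed `ξ⁽ʳ⁾`, the two fitted models, and the seed `ζ⁽ʳ⁾` of the procedure. -/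
structure RoundRecord (X Y Yhat : Type*) where
  data : DataSet (X × Y)
  xi : I
  model₀ : X → Yhat
  model₁ : X → Yhat
  zeta : I

/-- The functions that specify a procedure with access to two algorithms only through calls to
them. The list argument holds the records of the rounds completed so far, the most recent one
first; its length tells the number of the round. -/
structure ComparisonProcedure (X Y Yhat : Type*) (N : ℕ) where
  /-- The next data set and algorithm seed, from the original data, the past and a fresh seed. -/
  query : (Fin N → X × Y) → List (RoundRecord X Y Yhat) → I → DataSet (X × Y) × I
  /-- The stopping criterion, consulted after each round. -/
  halt : (Fin N → X × Y) → List (RoundRecord X Y Yhat) → Bool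
  /-- The final output, from the original data, all rounds and a last fresh seed. -/
  final : (Fin N → X × Y) → List (RoundRecord X Y Yhat) → I → Bool

namespace ComparisonProcedure

/-- The records of the first `r` rounds (if the procedure is never stopped). -/
def history {X Y Yhat : Type*} [MeasurableSpace X] [MeasurableSpace Y] [MeasurableSpace Yhat]
    {N : ℕ} (T : ComparisonProcedure X Y Yhat N) (A₀ A₁ : Algorithm X Y Yhat)
    (D : Fin N → X × Y) (ζ : ℕ → I) : ℕ → List (RoundRecord X Y Yhat)
  | 0 => []
  | r + 1 =>
    let past := history T A₀ A₁ D ζ r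
    let c := T.query D past (ζ r)
    { data := c.1
      xi := c.2
      model₀ := A₀.fit c.1 c.2
      model₁ := A₁.fit c.1 c.2
      zeta := ζ r } :: past

/-- The numbers of rounds (at least one) after which the stopping criterion holds. -/
def stoppingRounds {X Y Yhat : Type*} [MeasurableSpace X] [MeasurableSpace Y]
    [MeasurableSpace Yhat] {N : ℕ} (T : ComparisonProcedure X Y Yhat N)
    (A₀ A₁ : Algorithm X Y Yhat) (D : Fin N → X × Y) (ζ : ℕ → I) : Set ℕ :=
  {r | 1 ≤ r ∧ T.halt D (T.history A₀ A₁ D ζ r) = true}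

open Classical in
/-- The output of the run with data `D`, round seeds `ζ` and final seed `ζ'`. The total number of
rounds is the first one at which the stopping criterion holds. A run that never stops is given
the output `false`. -/
noncomputable def output {X Y Yhat : Type*} [MeasurableSpace X] [MeasurableSpace Y]
    [MeasurableSpace Yhat] {N : ℕ} (T : ComparisonProcedure X Y Yhat N)
    (A₀ A₁ : Algorithm X Y Yhat) (D : Fin N → X × Y) (ζ : ℕ → I) (ζ' : I) : Bool :=
  if (T.stoppingRounds A₀ A₁ D ζ).Nonempty then
    T.final D (T.history A₀ A₁ D ζ (sInf (T.stoppingRounds A₀ A₁ D ζ))) ζ'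
  else false

end ComparisonProcedure

/-- The joint law of `N` i.i.d. data points from `P` and of the i.i.d. uniform seeds
`ζ⁽¹⁾, ζ⁽²⁾, …` and `ζ`. -/
noncomputable def runLaw {Z : Type*} [MeasurableSpace Z] (P : Measure Z) (N : ℕ) :
    Measure ((Fin N → Z) × (ℕ → I) × I) :=
  (Measure.pi (fun _ : Fin N => P)).prod
    ((Measure.infinitePi (fun _ : ℕ => (volume : Measure I))).prod volume)

namespace ComparisonProcedure

/-- The procedure is a black-box test: on every pair of algorithms, its output is a measurable
function of the data and the seeds, and it almost surely stops after finitely many rounds,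
whatever the data distribution. -/
structure IsBlackBoxTest {X Y Yhat : Type*} [MeasurableSpace X] [MeasurableSpace Y]
    [MeasurableSpace Yhat] {N : ℕ} (T : ComparisonProcedure X Y Yhat N) : Prop where
  measurable_output : ∀ A₀ A₁ : Algorithm X Y Yhat, Measurable
    (fun ω : (Fin N → X × Y) × (ℕ → I) × I => T.output A₀ A₁ ω.1 ω.2.1 ω.2.2)
  stops : ∀ (A₀ A₁ : Algorithm X Y Yhat) (P : Measure (X × Y)), IsProbabilityMeasure P →
    ∀ᵐ ω ∂(runLaw P N), (T.stoppingRounds A₀ A₁ ω.1 ω.2.1).Nonempty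

/-- The probability that the test returns `1`, when the data are `N` i.i.d. points from `P`. -/
noncomputable def rejectionProb {X Y Yhat : Type*} [MeasurableSpace X] [MeasurableSpace Y]
    [MeasurableSpace Yhat] {N : ℕ} (T : ComparisonProcedure X Y Yhat N)
    (A₀ A₁ : Algorithm X Y Yhat) (P : Measure (X × Y)) : ℝ :=
  (runLaw P N).real {ω | T.output A₀ A₁ ω.1 ω.2.1 ω.2.2 = true}

end ComparisonProcedure

/-! The bound comes from a trap that the test almost never springs. Take models f₀, f₁ whose
comparison risk d is close to `deltaMax`, and a point z. Let A₀' return f₁ and A₁' return f₀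
(swapped) when the data contain z, and let them act as A₀, A₁ otherwise (`trigger`). Replace P by P'
= aP + (1-a)δ_z (`contaminate`). A training sample from P' misses z with probability at most a^n, so
the comparison risk under P' is at most a(a^n Δ - (1-a^n)d) + (1-a)B, up to a term in P{z}
(`algDelta_trigger_le`). A suitable a makes this negative (`exists_weight`). Stability survives
(`stability_trigger_le`), because deleting a point disarms the trap only if that point is the sole
occurrence of z. Validity thus bounds the rejection probability of (A₀', A₁') under P' by α, and P'
≥ aP bounds it under P by α / a^N (`pow_mul_rejectionProb_le`).

To return to A₀, A₁, keep a fixed and let z run through infinitely many distinct points. Almost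
every run stops after finitely many finite queries, so it eventually does not query z and cannot
tell the two pairs apart. Hence the rejection probabilities under P converge
(`tendsto_rejectionProb_trigger`), while P{z} → 0. -/

open Filter Topology NNReal

/-! ### Contamination by a point mass and its effect on samples. -/

section Measure

variable {Z : Type*} [MeasurableSpace Z]

/-- The product outer measure is the largest one dominated by the product on boxes, so comparing
boxes suffices. -/
theorem MeasureTheory.Measure.pi_mono_of_le {ι : Type*} [Fintype ι] {μ ν : Measure Z}
    [SigmaFinite μ] (h : μ ≤ ν) :
    Measure.pi (fun _ : ι => μ) ≤ Measure.pi (fun _ : ι => ν) := by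
  have key : (Measure.pi (fun _ : ι => μ)).toOuterMeasure ≤
      OuterMeasure.pi (fun _ : ι => ν.toOuterMeasure) := by
    rw [OuterMeasure.le_pi]
    intro s _
    have := Measure.pi_pi (fun _ : ι => μ) s
    calc Measure.pi (fun _ : ι => μ) (Set.univ.pi s) = ∏ i, μ (s i) := this
      _ ≤ ∏ i, ν (s i) := Finset.prod_le_prod' fun i _ => h (s i)
  refine Measure.le_iff.2 fun s hs => ?_
  conv_rhs => rw [Measure.pi, toMeasure_apply _ _ hs]
  exact key s

theorem MeasureTheory.Measure.pi_const_smul {ι : Type*} [Fintype ι] (a : ℝ≥0) (μ : Measure Z)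
    [IsFiniteMeasure μ] :
    Measure.pi (fun _ : ι => a • μ) = a ^ Fintype.card ι • Measure.pi (fun _ : ι => μ) := by
  refine Measure.pi_eq fun s _ => ?_
  simp only [Measure.smul_apply, Measure.pi_pi, ENNReal.smul_def, smul_eq_mul,
    Finset.prod_mul_distrib, Finset.prod_const, Finset.card_univ, ENNReal.coe_pow]

/-- The mixture of `P`, with weight `a`, and the point mass at `z`, with weight `1 - a`. -/
noncomputable def contaminate (a : ℝ≥0) (P : Measure Z) (z : Z) : Measure Z :=
  a • P + (1 - a) • Measure.dirac z

theorem isProbabilityMeasure_contaminate {a : ℝ≥0} (ha : a ≤ 1) (P : Measure Z)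
    [IsProbabilityMeasure P] (z : Z) : IsProbabilityMeasure (contaminate a P z) := by
  constructor
  simp only [contaminate, Measure.coe_add, Pi.add_apply, Measure.smul_apply, measure_univ,
    ENNReal.smul_def, smul_eq_mul, mul_one]
  rw [← ENNReal.coe_add, add_tsub_cancel_of_le ha, ENNReal.coe_one]

theorem smul_le_contaminate (a : ℝ≥0) (P : Measure Z) (z : Z) : a • P ≤ contaminate a P z :=
  Measure.le_add_right le_rfl

theorem integral_contaminate {a : ℝ≥0} (ha : a ≤ 1) (P : Measure Z) [MeasurableSingletonClass Z]
    (z : Z) {f : Z → ℝ} (hf : Integrable f P) :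
    ∫ x, f x ∂(contaminate a P z) = a * ∫ x, f x ∂P + (1 - a) * f z := by
  have hd : Integrable f (Measure.dirac z) := integrable_dirac (by simp)
  rw [contaminate, integral_add_measure (hf.smul_measure_nnreal) (hd.smul_measure_nnreal),
    integral_smul_nnreal_measure, integral_smul_nnreal_measure, integral_dirac]
  simp [NNReal.smul_def, NNReal.coe_sub ha]

theorem restrict_contaminate (a : ℝ≥0) (P : Measure Z) [MeasurableSingletonClass Z] (z : Z) :
    (contaminate a P z).restrict {z}ᶜ = a • P.restrict {z}ᶜ := by
  have h : (Measure.dirac z).restrict {z}ᶜ = 0 := by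
    rw [Measure.restrict_eq_zero]; simp
  rw [contaminate, Measure.restrict_add, Measure.restrict_smul, Measure.restrict_smul, h,
    smul_zero, add_zero]

/-- The samples that do not contain `z`. -/
def avoiding (n : ℕ) (z : Z) : Set (Fin n → Z) := Set.univ.pi fun _ => {z}ᶜ

omit [MeasurableSpace Z] in
theorem mem_avoiding {n : ℕ} {z : Z} {D : Fin n → Z} : D ∈ avoiding n z ↔ ∀ i, D i ≠ z := by
  simp [avoiding]

theorem measurableSet_avoiding [MeasurableSingletonClass Z] (n : ℕ) (z : Z) :
    MeasurableSet (avoiding n z) :=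
  MeasurableSet.univ_pi fun _ => (measurableSet_singleton z).compl

instance (P : Measure Z) [IsProbabilityMeasure P] (n : ℕ) :
    IsProbabilityMeasure (trainingLaw P n) := by
  unfold trainingLaw; infer_instance

instance (P : Measure Z) [IsProbabilityMeasure P] (N : ℕ) :
    IsProbabilityMeasure (runLaw P N) := by
  unfold runLaw; infer_instance

/-- Off z the point mass is invisible and each coordinate contributes a factor a. Equality holds
even if P has an atom at z. -/
theorem restrict_trainingLaw_contaminate [MeasurableSingletonClass Z] {a : ℝ≥0} (ha : a ≤ 1)
    (P : Measure Z) [IsProbabilityMeasure P] (n : ℕ) (z : Z) :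
    (trainingLaw (contaminate a P z) n).restrict (avoiding n z ×ˢ Set.univ) =
      a ^ n • (trainingLaw P n).restrict (avoiding n z ×ˢ Set.univ) := by
  have := isProbabilityMeasure_contaminate ha P z
  rw [trainingLaw, trainingLaw, ← Measure.prod_restrict, ← Measure.prod_restrict, avoiding,
    Measure.restrict_pi_pi, Measure.restrict_pi_pi]
  simp_rw [restrict_contaminate]
  rw [Measure.pi_const_smul, Measure.prod_smul_left, Fintype.card_fin]

theorem setIntegral_trainingLaw_contaminate [MeasurableSingletonClass Z] {a : ℝ≥0} (ha : a ≤ 1)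
    (P : Measure Z) [IsProbabilityMeasure P] (n : ℕ) (z : Z) (f : (Fin n → Z) × I → ℝ) :
    ∫ ω in avoiding n z ×ˢ Set.univ, f ω ∂(trainingLaw (contaminate a P z) n) =
      (a : ℝ) ^ n * ∫ ω in avoiding n z ×ˢ Set.univ, f ω ∂(trainingLaw P n) := by
  rw [restrict_trainingLaw_contaminate ha, integral_smul_nnreal_measure]
  simp [NNReal.smul_def]

theorem smul_runLaw_le {a : ℝ≥0} (ha : a ≤ 1) (P : Measure Z) [IsProbabilityMeasure P] (N : ℕ)
    (z : Z) : a ^ N • runLaw P N ≤ runLaw (contaminate a P z) N := by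
  have := isProbabilityMeasure_contaminate ha P z
  have h := Measure.pi_mono_of_le (ι := Fin N) (smul_le_contaminate a P z)
  rw [Measure.pi_const_smul, Fintype.card_fin] at h
  rw [runLaw, runLaw, ← Measure.prod_smul_left]
  exact Measure.prod_mono h le_rfl

theorem contaminate_singleton_compl [MeasurableSingletonClass Z] (a : ℝ≥0) (P : Measure Z)
    (z : Z) : contaminate a P z {z}ᶜ = a * P {z}ᶜ := by
  have h := congrArg (fun μ : Measure Z => μ Set.univ) (restrict_contaminate a P z)
  simpa using h

theorem contaminate_singleton_le [MeasurableSingletonClass Z] {a : ℝ≥0} (ha : a ≤ 1)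
    (P : Measure Z) [IsProbabilityMeasure P] (z : Z) :
    (contaminate a P z).real {z} ≤ 1 - a + P.real {z} := by
  have h1 := ENNReal.toReal_mono (b := a * P {z} + (1 - a : ℝ≥0)) (by finiteness)
    (a := contaminate a P z {z}) (by
      simp [contaminate])
  rw [ENNReal.toReal_add (by finiteness) (by finiteness), ENNReal.toReal_mul] at h1
  simp only [ENNReal.coe_toReal, NNReal.coe_sub ha, NNReal.coe_one] at h1
  have : (a : ℝ) ≤ 1 := by exact_mod_cast ha
  have h2 : (0 : ℝ) ≤ (P {z}).toReal := ENNReal.toReal_nonneg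
  simp only [Measure.real]
  nlinarith

/-- The samples in which `z` occurs precisely in position `j`. -/
def onlyAt {n : ℕ} (z : Z) (j : Fin n) : Set (Fin n → Z) :=
  Set.univ.pi fun i => if i = j then {z} else {z}ᶜ

omit [MeasurableSpace Z] in
theorem mem_onlyAt {n : ℕ} {z : Z} {j : Fin n} {D : Fin n → Z} :
    D ∈ onlyAt z j ↔ D j = z ∧ ∀ i, i ≠ j → D i ≠ z := by
  simp only [onlyAt, Set.mem_univ_pi]
  refine ⟨fun h => ⟨by simpa using h j, fun i hi => by simpa [hi] using h i⟩, fun h i => ?_⟩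
  by_cases hi : i = j
  · subst hi; simpa using h.1
  · simpa [hi] using h.2 i hi

theorem measurableSet_onlyAt [MeasurableSingletonClass Z] {n : ℕ} (z : Z) (j : Fin n) :
    MeasurableSet (onlyAt z j) := by
  refine MeasurableSet.univ_pi fun i => ?_
  split_ifs
  · exact measurableSet_singleton z
  · exact (measurableSet_singleton z).compl

theorem trainingLaw_onlyAt_le [MeasurableSingletonClass Z] {a : ℝ≥0} (ha : a ≤ 1)
    (P : Measure Z) [IsProbabilityMeasure P] (m : ℕ) (z : Z) (j : Fin (m + 1)) :
    (trainingLaw (contaminate a P z) (m + 1)).real (onlyAt z j ×ˢ Set.univ) ≤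
      (1 - a + P.real {z}) * (a : ℝ) ^ m := by
  have := isProbabilityMeasure_contaminate ha P z
  have hz := contaminate_singleton_le ha P z
  have hc : (contaminate a P z).real {z}ᶜ ≤ a := by
    rw [Measure.real, contaminate_singleton_compl, ENNReal.toReal_mul, ENNReal.coe_toReal]
    exact mul_le_of_le_one_right a.2 measureReal_le_one
  have h : (trainingLaw (contaminate a P z) (m + 1)).real (onlyAt z j ×ˢ Set.univ) =
      (contaminate a P z).real {z} * (contaminate a P z).real {z}ᶜ ^ m := by
    rw [Measure.real, trainingLaw, Measure.prod_prod, measure_univ, mul_one, onlyAt,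
      Measure.pi_pi, Fin.prod_univ_succAbove _ j, ENNReal.toReal_mul, ENNReal.toReal_prod]
    simp [Fin.succAbove_ne, Measure.real]
  have ha' : (0 : ℝ) ≤ 1 - a := sub_nonneg.2 (by exact_mod_cast ha)
  rw [h]
  gcongr

theorem trainingLaw_not_avoiding_ge [MeasurableSingletonClass Z] {a : ℝ≥0} (ha : a ≤ 1)
    (P : Measure Z) [IsProbabilityMeasure P] (n : ℕ) (z : Z) :
    1 - (a : ℝ) ^ n ≤
      (trainingLaw (contaminate a P z) n).real (avoiding n z ×ˢ Set.univ)ᶜ := by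
  have := isProbabilityMeasure_contaminate ha P z
  rw [probReal_compl_eq_one_sub ((measurableSet_avoiding n z).prod .univ)]
  have h := setIntegral_trainingLaw_contaminate ha P n z (fun _ => 1)
  simp only [integral_const, smul_eq_mul, mul_one, measureReal_restrict_apply_univ] at h
  rw [h]
  have : (a : ℝ) ^ n * (trainingLaw P n).real (avoiding n z ×ˢ Set.univ) ≤ a ^ n :=
    mul_le_of_le_one_right (by positivity) measureReal_le_one
  linarith

theorem trainingLaw_not_avoiding_le [MeasurableSingletonClass Z]
    (P : Measure Z) [IsProbabilityMeasure P] (n : ℕ) (z : Z) :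
    (trainingLaw P n).real (avoiding n z ×ˢ Set.univ)ᶜ ≤ n * P.real {z} := by
  have h : (avoiding n z ×ˢ (Set.univ : Set I))ᶜ =
      ⋃ i : Fin n, {D : Fin n → Z | D i = z} ×ˢ (Set.univ : Set I) := by
    ext ω
    simp [mem_avoiding]
  rw [h]
  refine (measureReal_iUnion_fintype_le _).trans ?_
  have : ∀ i : Fin n, (trainingLaw P n).real
      ({D : Fin n → Z | D i = z} ×ˢ (Set.univ : Set I)) = P.real {z} := by
    intro i
    rw [Measure.real, trainingLaw, Measure.prod_prod, measure_univ, mul_one]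
    exact congrArg ENNReal.toReal ((measurePreserving_eval (fun _ : Fin n => P)
      i).measure_preimage (measurableSet_singleton z).nullMeasurableSet)
  simp [this]

end Measure

/-! ### Triggered algorithms and their comparison risk. -/

section Algorithms

variable {X Y Yhat : Type*} [MeasurableSpace X] [MeasurableSpace Y] [MeasurableSpace Yhat]

namespace Algorithm

variable [MeasurableSingletonClass X] [MeasurableSingletonClass Y]

open Classical in
/-- The algorithm that returns the fixed model `f` on data sets containing `z`, and otherwise
agrees with `A`. -/
noncomputable def trigger (A : Algorithm X Y Yhat) (z : X × Y) (f : X → Yhat)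
    (hf : Measurable f) : Algorithm X Y Yhat where
  fit D ξ := if ∀ i, D.2 i ≠ z then A.fit D ξ else f
  measurable_fit m := by
    have hE : MeasurableSet {p : (Fin m → X × Y) × I × X | ∀ i, p.1 i ≠ z} := by
      convert measurable_fst (β := I × X) (measurableSet_avoiding m z) using 1
      ext p
      exact mem_avoiding.symm
    have h : Measurable fun p : (Fin m → X × Y) × I × X =>
        if ∀ i, p.1 i ≠ z then A.fit ⟨m, p.1⟩ p.2.1 p.2.2 else f p.2.2 := Measurable.ite hE (A.measurable_fit m) (hf.comp measurable_snd.snd)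
    convert h using 2 with p
    by_cases hp : ∀ i, p.1 i ≠ z
    · simp only [if_pos hp]
    · simp only [if_neg hp]

variable (A : Algorithm X Y Yhat) {z : X × Y} {f : X → Yhat} (hf : Measurable f)

theorem trigger_fit_of_forall {D : DataSet (X × Y)} (h : ∀ i, D.2 i ≠ z) (ξ : I) :
    (A.trigger z f hf).fit D ξ = A.fit D ξ := if_pos h

theorem trigger_fit_of_exists {D : DataSet (X × Y)} (h : ∃ i, D.2 i = z) (ξ : I) :
    (A.trigger z f hf).fit D ξ = f := if_neg (by push Not; exact h)

end Algorithm

theorem Algorithm.measurable_fit_prod (A : Algorithm X Y Yhat) (m : ℕ) :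
    Measurable fun p : ((Fin m → X × Y) × I) × (X × Y) => A.fit ⟨m, p.1.1⟩ p.1.2 p.2.1 :=
  (A.measurable_fit m).comp (measurable_fst.fst.prodMk
    (measurable_fst.snd.prodMk measurable_snd.fst))

section Loss

variable {B : ℝ} {ℓ : Yhat → Y → ℝ}

omit [MeasurableSpace Y] [MeasurableSpace Yhat] in
theorem abs_lossDifference_le (hB : ∀ yhat y, ℓ yhat y ∈ Set.Icc 0 B) (y' y'' : Yhat) (y : Y) :
    |lossDifference ℓ y' y'' y| ≤ B := by
  have h1 := hB y' y
  have h2 := hB y'' y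
  rw [lossDifference, abs_le]
  constructor <;> linarith [h1.1, h1.2, h2.1, h2.2]

theorem measurable_lossDifference (hℓ : Measurable (Function.uncurry ℓ)) {Ω : Type*}
    [MeasurableSpace Ω] {f g : Ω → Yhat} {y : Ω → Y} (hf : Measurable f) (hg : Measurable g)
    (hy : Measurable y) : Measurable fun ω => lossDifference ℓ (f ω) (g ω) (y ω) :=
  (hℓ.comp (hf.prodMk hy)).sub (hℓ.comp (hg.prodMk hy))

theorem integrable_of_abs_le {Ω : Type*} [MeasurableSpace Ω] {μ : Measure Ω} [IsFiniteMeasure μ]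
    {f : Ω → ℝ} (hf : Measurable f) {C : ℝ} (h : ∀ ω, |f ω| ≤ C) : Integrable f μ :=
  Integrable.of_bound hf.aestronglyMeasurable C (ae_of_all _ h)

theorem abs_integral_le_of_abs_le {Ω : Type*} [MeasurableSpace Ω] {μ : Measure Ω}
    [IsProbabilityMeasure μ] {f : Ω → ℝ} {C : ℝ} (h : ∀ ω, |f ω| ≤ C) : |∫ ω, f ω ∂μ| ≤ C := by
  simpa using norm_integral_le_of_norm_le_const (μ := μ) (f := f) (ae_of_all _ h)

omit [MeasurableSpace Yhat] in
theorem modelDelta_neg (ℓ : Yhat → Y → ℝ) (P : Measure (X × Y)) (f₀ f₁ : X → Yhat) :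
    modelDelta (lossDifference ℓ) P f₁ f₀ = -modelDelta (lossDifference ℓ) P f₀ f₁ := by
  rw [modelDelta, modelDelta, ← integral_neg]
  simp [lossDifference]

variable (hℓ : Measurable (Function.uncurry ℓ)) (hB : ∀ yhat y, ℓ yhat y ∈ Set.Icc 0 B)
include hB

omit [MeasurableSpace Yhat] in
theorem abs_modelDelta_le (P : Measure (X × Y)) [IsProbabilityMeasure P] (f₀ f₁ : X → Yhat) :
    |modelDelta (lossDifference ℓ) P f₀ f₁| ≤ B :=
  abs_integral_le_of_abs_le fun _ => abs_lossDifference_le hB _ _ _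

include hℓ

theorem integrable_modelDelta_fit (A₀ A₁ : Algorithm X Y Yhat) (P Q : Measure (X × Y))
    [IsProbabilityMeasure P] [IsProbabilityMeasure Q] (n : ℕ) :
    Integrable (fun ω => modelDelta (lossDifference ℓ) Q (A₀.fit ⟨n, ω.1⟩ ω.2)
      (A₁.fit ⟨n, ω.1⟩ ω.2)) (trainingLaw P n) := by
  have h := measurable_lossDifference hℓ (A₀.measurable_fit_prod n) (A₁.measurable_fit_prod n)
    measurable_snd.snd
  refine integrable_of_abs_le ?_ (fun ω => abs_modelDelta_le hB Q _ _)
  exact (h.stronglyMeasurable.integral_prod_right (ν := Q)).measurable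

variable [MeasurableSingletonClass X] [MeasurableSingletonClass Y]

theorem modelDelta_contaminate_le {a : ℝ≥0} (ha : a ≤ 1) (P : Measure (X × Y))
    [IsProbabilityMeasure P] (z : X × Y) {f₀ f₁ : X → Yhat} (h₀ : Measurable f₀)
    (h₁ : Measurable f₁) :
    modelDelta (lossDifference ℓ) (contaminate a P z) f₀ f₁ ≤
      a * modelDelta (lossDifference ℓ) P f₀ f₁ + (1 - a) * B := by
  have h : Measurable fun x : X × Y => lossDifference ℓ (f₀ x.1) (f₁ x.1) x.2 :=
    measurable_lossDifference hℓ (h₀.comp measurable_fst) (h₁.comp measurable_fst)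
      measurable_snd
  rw [modelDelta, integral_contaminate ha P z
    (integrable_of_abs_le h fun _ => abs_lossDifference_le hB _ _ _)]
  have h1 : (0 : ℝ) ≤ 1 - a := sub_nonneg.2 (by exact_mod_cast ha)
  have h2 := (abs_le.1 (abs_lossDifference_le hB (f₀ z.1) (f₁ z.1) z.2)).2
  exact add_le_add le_rfl (mul_le_mul_of_nonneg_left h2 h1)

theorem algDelta_trigger_le {a : ℝ≥0} (ha : a ≤ 1) (P : Measure (X × Y))
    [IsProbabilityMeasure P] (n : ℕ) (z : X × Y) (A₀ A₁ : Algorithm X Y Yhat)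
    {f₀ f₁ : X → Yhat} (h₀ : Measurable f₀) (h₁ : Measurable f₁)
    (hd : 0 ≤ modelDelta (lossDifference ℓ) P f₀ f₁) :
    algDelta (lossDifference ℓ) (contaminate a P z) n (A₀.trigger z f₁ h₁)
        (A₁.trigger z f₀ h₀) ≤
      a * (a ^ n * (algDelta (lossDifference ℓ) P n A₀ A₁ + n * P.real {z} * B) -
        (1 - a ^ n) * modelDelta (lossDifference ℓ) P f₀ f₁) + (1 - a) * B := by
  have hP' := isProbabilityMeasure_contaminate ha P z
  set P' := contaminate a P z
  set A₀' := A₀.trigger z f₁ h₁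
  set A₁' := A₁.trigger z f₀ h₀
  set E : Set ((Fin n → X × Y) × I) := avoiding n z ×ˢ Set.univ
  have hE : MeasurableSet E := (measurableSet_avoiding n z).prod .univ
  set d := modelDelta (lossDifference ℓ) P f₀ f₁
  set h : (Fin n → X × Y) × I → ℝ := fun ω =>
    modelDelta (lossDifference ℓ) P (A₀.fit ⟨n, ω.1⟩ ω.2) (A₁.fit ⟨n, ω.1⟩ ω.2)
  set h' : (Fin n → X × Y) × I → ℝ := fun ω =>
    modelDelta (lossDifference ℓ) P (A₀'.fit ⟨n, ω.1⟩ ω.2) (A₁'.fit ⟨n, ω.1⟩ ω.2)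
  have hi : Integrable h (trainingLaw P n) := integrable_modelDelta_fit hℓ hB A₀ A₁ P P n
  have hi' : Integrable h' (trainingLaw P' n) := integrable_modelDelta_fit hℓ hB A₀' A₁' P' P n
  have hmeas : ∀ (A : Algorithm X Y Yhat) (ω : (Fin n → X × Y) × I),
      Measurable (A.fit ⟨n, ω.1⟩ ω.2) := fun A ω =>
    (A.measurable_fit n).comp (measurable_const.prodMk (measurable_const.prodMk measurable_id))
  -- Contamination of the test point: z is drawn with extra weight 1 - a and contributes at most B.
  have step1 : algDelta (lossDifference ℓ) P' n A₀' A₁' ≤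
      a * ∫ ω, h' ω ∂(trainingLaw P' n) + (1 - a) * B := by
    have : ∫ ω, (a * h' ω + (1 - a) * B) ∂(trainingLaw P' n) =
        a * ∫ ω, h' ω ∂(trainingLaw P' n) + (1 - a) * B := by
      rw [integral_add (hi'.const_mul _) (integrable_const _), integral_const_mul]
      simp
    rw [← this]
    exact integral_mono (integrable_modelDelta_fit hℓ hB A₀' A₁' P' P' n)
      ((hi'.const_mul _).add (integrable_const _))
      fun ω => modelDelta_contaminate_le hℓ hB ha P z (hmeas A₀' ω) (hmeas A₁' ω)
  have step2 : ∫ ω in E, h' ω ∂(trainingLaw P' n) =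
      (a : ℝ) ^ n * ∫ ω in E, h ω ∂(trainingLaw P n) := by
    rw [← setIntegral_trainingLaw_contaminate ha]
    refine setIntegral_congr_fun hE fun ω hω => ?_
    have hω' := mem_avoiding.1 hω.1
    simp only [h', h]
    rw [A₀.trigger_fit_of_forall h₁ (D := ⟨n, ω.1⟩) hω',
      A₁.trigger_fit_of_forall h₀ (D := ⟨n, ω.1⟩) hω']
  -- Once z is in the sample, the swapped models are compared, which reverses the sign of d.
  have step3 : ∫ ω in Eᶜ, h' ω ∂(trainingLaw P' n) = -((trainingLaw P' n).real Eᶜ * d) := by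
    rw [setIntegral_congr_fun (g := fun _ => -d) hE.compl, setIntegral_const, smul_eq_mul,
      mul_neg]
    intro ω hω
    have hω' : ∃ i, ω.1 i = z := by
      by_contra hc
      push Not at hc
      exact hω ⟨mem_avoiding.2 hc, trivial⟩
    simp only [h']
    rw [A₀.trigger_fit_of_exists h₁ (D := ⟨n, ω.1⟩) hω',
      A₁.trigger_fit_of_exists h₀ (D := ⟨n, ω.1⟩) hω', modelDelta_neg]
  have hB0 : 0 ≤ B := (abs_nonneg _).trans (abs_modelDelta_le hB P f₀ f₁)
  -- Discarding the samples from P that hit z costs at most B times their probability, by a union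
  -- bound.
  have step4 : ∫ ω in E, h ω ∂(trainingLaw P n) ≤
      algDelta (lossDifference ℓ) P n A₀ A₁ + n * P.real {z} * B := by
    have e : ∫ ω in E, h ω ∂(trainingLaw P n) + ∫ ω in Eᶜ, h ω ∂(trainingLaw P n) =
      algDelta (lossDifference ℓ) P n A₀ A₁ := integral_add_compl hE hi
    have l : |∫ ω in Eᶜ, h ω ∂(trainingLaw P n)| ≤ B * (trainingLaw P n).real Eᶜ :=
      norm_setIntegral_le_of_norm_le_const (f := h) (measure_lt_top _ _)
        fun ω _ => abs_modelDelta_le hB P _ _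
    have m := mul_le_mul_of_nonneg_left (trainingLaw_not_avoiding_le P n z) hB0
    linarith [(abs_le.1 l).1]
  have step5 := trainingLaw_not_avoiding_ge ha P n z
  have e' := integral_add_compl hE hi'
  rw [step2, step3] at e'
  refine step1.trans (add_le_add (mul_le_mul_of_nonneg_left ?_ a.2) le_rfl)
  rw [← e', ← sub_eq_add_neg]
  exact sub_le_sub (mul_le_mul_of_nonneg_left step4 (by positivity))
    (mul_le_mul_of_nonneg_right step5 hd)

end Loss

end Algorithms

/-! ### Stability of the triggered algorithms. -/

section Stability

variable {X Y Yhat : Type*} [MeasurableSpace X] [MeasurableSpace Y] [MeasurableSpace Yhat]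

theorem stability_le_iff {ℓ : Yhat → Y → ℝ} {q : ℕ} (hq : q ≠ 0) {n : ℕ} (hn : 1 ≤ n)
    {A : Algorithm X Y Yhat} {P : Measure (X × Y)} {γ : ℝ} (hγ : 0 ≤ γ) :
    stability ℓ q A P n ≤ γ ↔ ∀ j : Fin n,
      ∫ ω, |ℓ (A.fit ⟨n, ω.1.1⟩ ω.1.2 ω.2.1) ω.2.2
          - ℓ (A.fit (deletePoint ω.1.1 j) ω.1.2 ω.2.1) ω.2.2| ^ q
      ∂((trainingLaw P n).prod P) ≤ γ ^ q := by
  have : Nonempty (Fin n) := ⟨⟨0, hn⟩⟩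
  rw [stability, ciSup_le_iff (Set.finite_range _).bddAbove]
  refine forall_congr' fun j => ?_
  rw [one_div, Real.rpow_inv_le_iff_of_pos (integral_nonneg fun _ => by positivity) hγ
    (by positivity), Real.rpow_natCast]

/-- In m + 1 independent trials, exactly one success is no likelier than at least one. -/
theorem mul_pow_le_one_sub_pow {a : ℝ} (h0 : 0 ≤ a) (h1 : a ≤ 1) (m : ℕ) :
    (m + 1) * ((1 - a) * a ^ m) ≤ 1 - a ^ (m + 1) := by
  have h : ((m : ℝ) + 1) * a ^ m ≤ ∑ i ∈ Finset.range (m + 1), a ^ i := by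
    have := Finset.card_nsmul_le_sum (Finset.range (m + 1)) (fun i => a ^ i) (a ^ m)
      fun i hi => pow_le_pow_of_le_one h0 h1 (Nat.lt_succ_iff.1 (Finset.mem_range.1 hi))
    simpa using this
  have := mul_neg_geom_sum a (m + 1)
  rw [← this]
  nlinarith [mul_le_mul_of_nonneg_left h (sub_nonneg.2 h1)]

/-- The budget for `stability_trigger_le`, with C = B^q and p = P{z}. The terms in C add up to at
most C(1-a)a^m (a + 1 + (1-a)) = 2C(1-a)a^m. This is at most Γ(1 - a^(m+1)), while the term in S is
at most Γa^(m+1). The bound on p is what makes the constant exactly 2. -/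
theorem contaminated_moment_le {a S C Γ p : ℝ} (h0 : 0 ≤ a) (h1 : a ≤ 1) (hC : 0 ≤ C) {m : ℕ}
    (hS : S ≤ Γ) (hΓ : 2 * C / (m + 1) ≤ Γ) (hp : p ≤ (1 - a) ^ 2) :
    a ^ (m + 1) * (a * S + (1 - a) * C) + C * ((1 - a + p) * a ^ m) ≤ Γ := by
  have hΓ' : 2 * C ≤ Γ * (m + 1) := by rwa [div_le_iff₀ (by positivity)] at hΓ
  have hΓ0 : 0 ≤ Γ := le_trans (by positivity) hΓ
  have ha := sub_nonneg.2 h1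
  have k1 := mul_le_mul_of_nonneg_left (mul_pow_le_one_sub_pow h0 h1 m) hΓ0
  have k2 := mul_le_mul_of_nonneg_right hΓ' (show 0 ≤ (1 - a) * a ^ m by positivity)
  have k3 := mul_le_mul_of_nonneg_left hp (show 0 ≤ C * a ^ m by positivity)
  have k4 := mul_le_mul_of_nonneg_left hS (show 0 ≤ a ^ (m + 1) * a by positivity)
  have k5 : 0 ≤ Γ * (a ^ (m + 1) * (1 - a)) := by positivity
  rw [pow_succ] at k1 k4 k5 ⊢
  linarith

theorem pow_moment_bound {B γ : ℝ} (hB : 0 ≤ B) {n q : ℕ} (hn : 1 ≤ n) (hq : 1 ≤ q)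
    (hγ : 2 * B / (n : ℝ) ^ (1 / (q : ℝ)) ≤ γ) : 2 * B ^ q / n ≤ γ ^ q := by
  have hn0 : (0 : ℝ) < n := by exact_mod_cast hn
  have h := pow_le_pow_left₀ (by positivity) hγ q
  rw [div_pow, mul_pow, one_div, Real.rpow_inv_natCast_pow hn0.le (by omega)] at h
  refine le_trans ?_ h
  gcongr
  exact le_self_pow₀ one_le_two (by omega)

variable [MeasurableSingletonClass X] [MeasurableSingletonClass Y]

theorem stability_trigger_le {B : ℝ} {ℓ : Yhat → Y → ℝ} (hℓ : Measurable (Function.uncurry ℓ))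
    (hB : ∀ yhat y, ℓ yhat y ∈ Set.Icc 0 B) (hB0 : 0 ≤ B) {q : ℕ} (hq : 1 ≤ q) {n : ℕ}
    (hn : 1 ≤ n) {γ : ℝ} (hγ : 2 * B / (n : ℝ) ^ (1 / (q : ℝ)) ≤ γ)
    {a : ℝ≥0} (ha : a ≤ 1) (P : Measure (X × Y)) [IsProbabilityMeasure P] (z : X × Y)
    (hz : P.real {z} ≤ (1 - a) ^ 2) {A : Algorithm X Y Yhat} (hA : stability ℓ q A P n ≤ γ)
    {f : X → Yhat} (hf : Measurable f) :
    stability ℓ q (A.trigger z f hf) (contaminate a P z) n ≤ γ := by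
  have hP' := isProbabilityMeasure_contaminate ha P z
  have hγ0 : 0 ≤ γ := le_trans (by positivity) hγ
  have hΓ := pow_moment_bound hB0 hn hq hγ
  rw [stability_le_iff (by omega) hn hγ0] at hA ⊢
  obtain ⟨m, rfl⟩ : ∃ m, n = m + 1 := ⟨n - 1, by omega⟩
  intro j
  specialize hA j
  set P' := contaminate a P z
  let G : Algorithm X Y Yhat → ((Fin (m + 1) → X × Y) × I) × (X × Y) → ℝ := fun A ω =>
    |ℓ (A.fit ⟨m + 1, ω.1.1⟩ ω.1.2 ω.2.1) ω.2.2
      - ℓ (A.fit (deletePoint ω.1.1 j) ω.1.2 ω.2.1) ω.2.2| ^ q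
  change ∫ ω, G A ω ∂_ ≤ _ at hA
  set A' := A.trigger z f hf
  change ∫ ω, G A' ω ∂_ ≤ _
  have hG0 : ∀ A ω, 0 ≤ G A ω := fun A ω => by positivity
  have hGB : ∀ A ω, G A ω ≤ B ^ q := fun A ω =>
    pow_le_pow_left₀ (abs_nonneg _) (abs_lossDifference_le hB _ _ _) q
  have hGabs : ∀ A ω, |G A ω| ≤ B ^ q := fun A ω => by rw [abs_of_nonneg (hG0 A ω)]; exact hGB A ω
  have hGm : ∀ A, Measurable (G A) := by
    intro A
    have hrem : Measurable fun D : Fin (m + 1) → X × Y => j.removeNth D :=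
      measurable_pi_iff.2 fun i => measurable_pi_apply _
    have hdel : Measurable fun p : ((Fin (m + 1) → X × Y) × I) × (X × Y) =>
        A.fit (deletePoint p.1.1 j) p.1.2 p.2.1 :=
      (A.measurable_fit m).comp ((hrem.comp measurable_fst.fst).prodMk
        (measurable_fst.snd.prodMk measurable_snd.fst))
    exact (measurable_lossDifference hℓ (A.measurable_fit_prod (m + 1)) hdel
      measurable_snd.snd).norm.pow_const q
  have hGi : ∀ A (μ : Measure (((Fin (m + 1) → X × Y) × I) × (X × Y))) [IsFiniteMeasure μ],
      Integrable (G A) μ := fun A μ _ => integrable_of_abs_le (hGm A) (hGabs A)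
  set E : Set ((Fin (m + 1) → X × Y) × I) := avoiding (m + 1) z ×ˢ Set.univ
  have hE : MeasurableSet E := (measurableSet_avoiding (m + 1) z).prod .univ
  set F : Set ((Fin (m + 1) → X × Y) × I) := onlyAt z j ×ˢ Set.univ
  have hF : MeasurableSet F := (measurableSet_onlyAt z j).prod .univ
  let h : (Fin (m + 1) → X × Y) × I → ℝ := fun ω => ∫ x, G A (ω, x) ∂P
  let h' : (Fin (m + 1) → X × Y) × I → ℝ := fun ω => ∫ x, G A' (ω, x) ∂P'
  have hi' : Integrable h' (trainingLaw P' (m + 1)) := (hGi A' _).integral_prod_left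
  have hh0 : ∀ ω, 0 ≤ h ω := fun ω => integral_nonneg fun x => hG0 _ _
  -- A sample without z still lacks z after deletion, so only the test point feels the
  -- contamination.
  have hon : ∀ ω ∈ E, h' ω ≤ a * h ω + (1 - a) * B ^ q := by
    intro ω hω
    have hω' := mem_avoiding.1 hω.1
    have hG : ∀ x, G A' (ω, x) = G A (ω, x) := by
      intro x
      simp only [G, A']
      rw [A.trigger_fit_of_forall hf (D := ⟨m + 1, ω.1⟩) hω',
        A.trigger_fit_of_forall hf (D := deletePoint ω.1 j) fun i => hω' _]
    simp only [h', hG]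
    rw [integral_contaminate ha P z (f := fun x => G A (ω, x)) (integrable_of_abs_le
      ((hGm A).comp measurable_prodMk_left) fun x => hGabs A _)]
    have h1 : (0 : ℝ) ≤ 1 - a := sub_nonneg.2 (by exact_mod_cast ha)
    exact add_le_add le_rfl (mul_le_mul_of_nonneg_left (hGB _ _) h1)
  -- If z occurs somewhere other than j, the trap is sprung both before and after deletion, and both
  -- fits equal f.
  have hoff : ∀ ω ∈ Eᶜ, h' ω ≤ F.indicator (fun _ => B ^ q) ω := by
    intro ω hω
    by_cases hωF : ω ∈ F
    · rw [Set.indicator_of_mem hωF]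
      exact (le_abs_self _).trans (abs_integral_le_of_abs_le fun x => hGabs A' _)
    · rw [Set.indicator_of_notMem hωF]
      have h1 : ∃ i, ω.1 i = z := by
        by_contra hc
        push Not at hc
        exact hω ⟨mem_avoiding.2 hc, trivial⟩
      have h2 : ∃ i, (deletePoint ω.1 j).2 i = z := by
        by_contra hc
        push Not at hc
        have hc' : ∀ i, i ≠ j → ω.1 i ≠ z := by
          intro i hij
          obtain ⟨i', rfl⟩ := Fin.exists_succAbove_eq hij
          exact hc i'
        obtain ⟨i, hiz⟩ := h1
        have hij : i = j := by by_contra hij; exact hc' i hij hiz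
        subst hij
        exact hωF ⟨mem_onlyAt.2 ⟨hiz, hc'⟩, trivial⟩
      have hG : ∀ x, G A' (ω, x) = 0 := by
        intro x
        simp only [G, A']
        rw [A.trigger_fit_of_exists hf (D := ⟨m + 1, ω.1⟩) h1,
          A.trigger_fit_of_exists hf (D := deletePoint ω.1 j) h2, sub_self, abs_zero,
          zero_pow (by omega)]
      simp [h', hG]
  have step0 : ∫ ω, G A' ω ∂((trainingLaw P' (m + 1)).prod P') =
      ∫ ω, h' ω ∂(trainingLaw P' (m + 1)) := integral_prod _ (hGi A' _)
  have stepA : ∫ ω, G A ω ∂((trainingLaw P (m + 1)).prod P) =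
      ∫ ω, h ω ∂(trainingLaw P (m + 1)) := integral_prod _ (hGi A _)
  rw [stepA] at hA
  have ha1 : (a : ℝ) ≤ 1 := by exact_mod_cast ha
  have hBq : 0 ≤ B ^ q := by positivity
  have hk : ∀ (μ : Measure ((Fin (m + 1) → X × Y) × I)) [IsFiniteMeasure μ], Integrable h μ := by
    intro μ _
    exact integrable_of_abs_le (hGm A).stronglyMeasurable.integral_prod_right.measurable
      fun ω => abs_integral_le_of_abs_le fun x => hGabs A _
  have stepE : ∫ ω in E, h' ω ∂(trainingLaw P' (m + 1)) ≤
      (a : ℝ) ^ (m + 1) * (a * ∫ ω, h ω ∂(trainingLaw P (m + 1)) + (1 - a) * B ^ q) := by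
    have hkc : ∀ (μ : Measure ((Fin (m + 1) → X × Y) × I)) [IsFiniteMeasure μ],
        Integrable (fun ω => a * h ω + (1 - a) * B ^ q) μ := fun μ _ =>
      ((hk μ).const_mul _).add (integrable_const _)
    calc ∫ ω in E, h' ω ∂(trainingLaw P' (m + 1))
        ≤ ∫ ω in E, (a * h ω + (1 - a) * B ^ q) ∂(trainingLaw P' (m + 1)) :=
          setIntegral_mono_on hi'.integrableOn (hkc _) hE hon
      _ = (a : ℝ) ^ (m + 1) *
          ∫ ω in E, (a * h ω + (1 - a) * B ^ q) ∂(trainingLaw P (m + 1)) :=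
          setIntegral_trainingLaw_contaminate ha P (m + 1) z _
      _ ≤ (a : ℝ) ^ (m + 1) * ∫ ω, (a * h ω + (1 - a) * B ^ q) ∂(trainingLaw P (m + 1)) := by
          refine mul_le_mul_of_nonneg_left (setIntegral_le_integral (hkc _)
            (ae_of_all _ fun ω => ?_)) (by positivity)
          exact add_nonneg (mul_nonneg a.2 (hh0 ω)) (mul_nonneg (sub_nonneg.2 ha1) hBq)
      _ = _ := by
          rw [integral_add ((hk _).const_mul _) (integrable_const _), integral_const_mul]
          simp
  have stepF : ∫ ω in Eᶜ, h' ω ∂(trainingLaw P' (m + 1)) ≤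
      B ^ q * ((1 - a + P.real {z}) * (a : ℝ) ^ m) := by
    have hFi : Integrable (F.indicator fun _ => B ^ q) (trainingLaw P' (m + 1)) :=
      (integrable_const _).indicator hF
    calc ∫ ω in Eᶜ, h' ω ∂(trainingLaw P' (m + 1))
        ≤ ∫ ω in Eᶜ, F.indicator (fun _ => B ^ q) ω ∂(trainingLaw P' (m + 1)) :=
          setIntegral_mono_on hi'.integrableOn hFi.integrableOn hE.compl hoff
      _ ≤ ∫ ω, F.indicator (fun _ => B ^ q) ω ∂(trainingLaw P' (m + 1)) :=
          setIntegral_le_integral hFi (ae_of_all _ fun ω => Set.indicator_nonneg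
            (fun _ _ => hBq) ω)
      _ = B ^ q * (trainingLaw P' (m + 1)).real F := by
          rw [integral_indicator_const _ hF, smul_eq_mul, mul_comm]
      _ ≤ _ := mul_le_mul_of_nonneg_left (trainingLaw_onlyAt_le ha P m z j) hBq
  rw [step0, ← integral_add_compl hE hi']
  push_cast at hΓ
  exact (add_le_add stepE stepF).trans (contaminated_moment_le a.2 ha1 hBq hA hΓ hz)

end Stability

/-! ### Runs of the test on the original and triggered algorithms. -/

section BlackBox

variable {X Y Yhat : Type*} [MeasurableSpace X] [MeasurableSpace Y] [MeasurableSpace Yhat]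
  [MeasurableSingletonClass X] [MeasurableSingletonClass Y]

namespace ComparisonProcedure

variable {N : ℕ} (T : ComparisonProcedure X Y Yhat N) (A₀ A₁ : Algorithm X Y Yhat)
  {f₀ f₁ : X → Yhat} (h₀ : Measurable f₀) (h₁ : Measurable f₁)

omit [MeasurableSingletonClass X] [MeasurableSingletonClass Y] in
theorem history_subset (D : Fin N → X × Y) (ζ : ℕ → I) {r s : ℕ} (h : r ≤ s) :
    T.history A₀ A₁ D ζ r ⊆ T.history A₀ A₁ D ζ s := by
  induction h with
  | refl => exact List.Subset.refl _
  | step _ ih => exact List.Subset.trans ih (List.subset_cons_self _ _)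

/-- Each query depends only on earlier records, so the runs cannot diverge before a query contains
z. The original data D may contain z: only queries are fitted. -/
theorem history_trigger {z : X × Y} (D : Fin N → X × Y) (ζ : ℕ → I) (r : ℕ)
    (hr : ∀ R ∈ T.history A₀ A₁ D ζ r, ∀ i, R.data.2 i ≠ z) :
    T.history (A₀.trigger z f₀ h₀) (A₁.trigger z f₁ h₁) D ζ r = T.history A₀ A₁ D ζ r := by
  induction r with
  | zero => rfl
  | succ r ih =>
    have ih' := ih fun R hR => hr R (T.history_subset A₀ A₁ D ζ (Nat.le_succ r) hR)
    have hc : ∀ i, (T.query D (T.history A₀ A₁ D ζ r) (ζ r)).1.2 i ≠ z :=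
      hr _ List.mem_cons_self
    simp only [history, ih']
    rw [A₀.trigger_fit_of_forall h₀ hc, A₁.trigger_fit_of_forall h₁ hc]

theorem output_trigger {z : X × Y} (D : Fin N → X × Y) (ζ : ℕ → I) (ζ' : I)
    (hs : (T.stoppingRounds A₀ A₁ D ζ).Nonempty)
    (hz : ∀ R ∈ T.history A₀ A₁ D ζ (sInf (T.stoppingRounds A₀ A₁ D ζ)),
      ∀ i, R.data.2 i ≠ z) :
    T.output (A₀.trigger z f₀ h₀) (A₁.trigger z f₁ h₁) D ζ ζ' = T.output A₀ A₁ D ζ ζ' := by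
  set S := T.stoppingRounds A₀ A₁ D ζ with hS
  set S' := T.stoppingRounds (A₀.trigger z f₀ h₀) (A₁.trigger z f₁ h₁) D ζ with hS'
  have hh : ∀ r ≤ sInf S, T.history (A₀.trigger z f₀ h₀) (A₁.trigger z f₁ h₁) D ζ r =
      T.history A₀ A₁ D ζ r := fun r hr => T.history_trigger A₀ A₁ h₀ h₁ D ζ r
    fun R hR => hz R (T.history_subset A₀ A₁ D ζ hr hR)
  have hmem : ∀ r ≤ sInf S, r ∈ S' ↔ r ∈ S := fun r hr => by
    simp only [hS, hS', stoppingRounds, Set.mem_ofPred_eq, hh r hr]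
  have hin : sInf S ∈ S' := (hmem _ le_rfl).2 (Nat.sInf_mem hs)
  have hinf : sInf S' = sInf S := by
    refine le_antisymm (Nat.sInf_le hin) ?_
    by_contra hlt
    push Not at hlt
    exact Nat.notMem_of_lt_sInf hlt ((hmem _ hlt.le).1 (Nat.sInf_mem ⟨_, hin⟩))
  rw [output, output, if_pos ⟨_, hin⟩, if_pos hs]
  rw [← hS', ← hS, hinf, hh _ le_rfl]

theorem tendsto_rejectionProb_trigger (hT : T.IsBlackBoxTest) (P : Measure (X × Y))
    [IsProbabilityMeasure P] {z : ℕ → X × Y} (hz : Function.Injective z) :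
    Tendsto (fun k => T.rejectionProb (A₀.trigger (z k) f₀ h₀) (A₁.trigger (z k) f₁ h₁) P) atTop
      (𝓝 (T.rejectionProb A₀ A₁ P)) := by
  have hmeas : ∀ A₀ A₁ : Algorithm X Y Yhat, MeasurableSet
      {ω : (Fin N → X × Y) × (ℕ → I) × I | T.output A₀ A₁ ω.1 ω.2.1 ω.2.2 = true} :=
    fun A₀ A₁ => hT.measurable_output A₀ A₁ (measurableSet_singleton true)
  -- For almost every outcome the indicators of rejection are eventually equal in k, so the
  -- probabilities converge.
  refine (ENNReal.tendsto_toReal (measure_ne_top _ _)).comp ?_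
  refine tendsto_measure_of_ae_tendsto_indicator_of_isFiniteMeasure atTop (hmeas A₀ A₁)
    (fun k => hmeas _ _) ?_
  filter_upwards [hT.stops A₀ A₁ P inferInstance] with ω hω
  have hfin : {x : X × Y | ∃ R ∈ T.history A₀ A₁ ω.1 ω.2.1
      (sInf (T.stoppingRounds A₀ A₁ ω.1 ω.2.1)), ∃ i, R.data.2 i = x}.Finite := by
    have : {x : X × Y | ∃ R ∈ T.history A₀ A₁ ω.1 ω.2.1
      (sInf (T.stoppingRounds A₀ A₁ ω.1 ω.2.1)), ∃ i, R.data.2 i = x} =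
      ⋃ R ∈ {R | R ∈ T.history A₀ A₁ ω.1 ω.2.1 (sInf (T.stoppingRounds A₀ A₁ ω.1 ω.2.1))},
        Set.range R.data.2 := by
      ext x; simp
    rw [this]
    exact (List.finite_toSet _).biUnion fun R _ => Set.finite_range _
  have hev := hz.tendsto_cofinite.eventually hfin.compl_mem_cofinite
  rw [Nat.cofinite_eq_atTop] at hev
  filter_upwards [hev] with k hk
  rw [T.output_trigger A₀ A₁ h₀ h₁ ω.1 ω.2.1 ω.2.2 hω]
  intro R hR i hi
  exact hk ⟨R, hR, i, hi⟩

omit [MeasurableSingletonClass X] [MeasurableSingletonClass Y] in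
theorem pow_mul_rejectionProb_le {a : ℝ≥0} (ha : a ≤ 1) (P : Measure (X × Y))
    [IsProbabilityMeasure P] (z : X × Y) :
    (a : ℝ) ^ N * T.rejectionProb A₀ A₁ P ≤ T.rejectionProb A₀ A₁ (contaminate a P z) := by
  have := isProbabilityMeasure_contaminate ha P z
  have h := ENNReal.toReal_mono (by finiteness)
    (smul_runLaw_le ha P N z {ω | T.output A₀ A₁ ω.1 ω.2.1 ω.2.2 = true})
  simpa [rejectionProb, Measure.real, ENNReal.smul_def] using h

end ComparisonProcedure

end BlackBox

/-! ### Choice of the parameters and conclusion. -/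

theorem tendsto_measureReal_singleton {Z : Type*} [MeasurableSpace Z]
    [MeasurableSingletonClass Z] (P : Measure Z) [IsProbabilityMeasure P] {z : ℕ → Z}
    (hz : Function.Injective z) : Tendsto (fun k => P.real {z k}) atTop (𝓝 0) := by
  have h : ∑' k, P {z k} ≠ ⊤ := by
    rw [← measure_iUnion (fun i j hij => by simpa using hz.ne hij)
      fun k => measurableSet_singleton _]
    exact measure_ne_top _ _
  exact (ENNReal.tendsto_toReal ENNReal.zero_ne_top).comp
    (ENNReal.tendsto_atTop_zero_of_tsum_ne_top h)

/-- The choice of the mixture weight `a`. -/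
theorem exists_weight {B D M α : ℝ} {n N : ℕ} (hB : 0 < B) (hD : 0 < D) (hα : 0 < α)
    (hα1 : α < 1) (hn : 1 ≤ n) (hN : 1 ≤ N) (hM : B * (α⁻¹ - 1) / N < M)
    (hlt : α * (1 + (D + B * (α⁻¹ - 1) / N) / (M - B * (α⁻¹ - 1) / N)) ^ ((N : ℝ) / n) < 1) :
    ∃ a : ℝ, 0 < a ∧ a < 1 ∧ a * (a ^ n * D - (1 - a ^ n) * M) + (1 - a) * B < 0 ∧
      α * (1 + (D + B * (α⁻¹ - 1) / N) / (M - B * (α⁻¹ - 1) / N)) ^ ((N : ℝ) / n) =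
        α / a ^ N := by
  set ε := B * (α⁻¹ - 1) / N with hε_def
  have hn0 : (0 : ℝ) < n := by exact_mod_cast hn
  have hN0 : (0 : ℝ) < N := by exact_mod_cast hN
  have hαi : 0 < α⁻¹ - 1 := sub_pos.2 ((one_lt_inv₀ hα).2 hα1)
  have hε : 0 < ε := by positivity
  have hMε : 0 < M - ε := sub_pos.2 hM
  have hMD : 0 < M + D := by linarith
  have hK : 1 + (D + ε) / (M - ε) = ((M - ε) / (M + D))⁻¹ := by
    field_simp
    ring
  -- Solves tD - (1 - t)M = -ε for t = a^n, leaving slack aε to absorb the test-point term (1 - a)B.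
  set t := (M - ε) / (M + D) with ht_def
  have ht0 : 0 < t := by positivity
  have ht1 : t < 1 := by rw [div_lt_one hMD]; linarith
  set a := t ^ (1 / (n : ℝ)) with ha_def
  have ha0 : 0 < a := Real.rpow_pos_of_pos ht0 _
  have ha1 : a < 1 := Real.rpow_lt_one ht0.le ht1 (by positivity)
  have han : a ^ n = t := by
    rw [ha_def, one_div, Real.rpow_inv_natCast_pow ht0.le (by omega)]
  have hpow : α * (1 + (D + ε) / (M - ε)) ^ ((N : ℝ) / n) = α / a ^ N := by
    rw [hK, div_eq_mul_inv α, ha_def, ← Real.rpow_natCast, ← Real.rpow_mul ht0.le,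
      Real.inv_rpow ht0.le, one_div_mul_eq_div]
  refine ⟨a, ha0, ha1, ?_, hpow⟩
  rw [hpow, div_lt_one (by positivity)] at hlt
  -- Bernoulli's inequality turns a nontrivial bound, α < a^N, into (1 - a)B < aε; this explains the
  -- value of ε.
  have hbern : 1 + N * ((1 - a) / a) ≤ (a ^ N)⁻¹ := by
    have h := one_add_mul_le_pow (show -2 ≤ (1 - a) / a from
      le_trans (by norm_num) (div_nonneg (sub_nonneg.2 ha1.le) ha0.le)) N
    have e : 1 + (1 - a) / a = a⁻¹ := by field_simp; ring
    rwa [e, inv_pow] at h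
  have hinv : (a ^ N)⁻¹ < α⁻¹ := (inv_lt_inv₀ (by positivity) hα).2 hlt
  have h1 : N * ((1 - a) / a) < α⁻¹ - 1 := by linarith
  have h2 : (1 - a) * B < a * ε := by
    rw [mul_div_assoc', div_lt_iff₀ ha0] at h1
    have := mul_lt_mul_of_pos_right h1 hB
    rw [hε_def, mul_div_assoc', lt_div_iff₀ hN0]
    linarith
  have h3 : a ^ n * D - (1 - a ^ n) * M = -ε := by
    rw [han, ht_def]
    field_simp
    ring
  rw [h3]
  linarith

theorem mainTheorem6 {X Y Yhat : Type*} [MeasurableSpace X] [MeasurableSpace Y]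
    [MeasurableSpace Yhat] [MeasurableSingletonClass X] [MeasurableSingletonClass Y]
    (hXY : Infinite X ∨ Infinite Y)
    (B : ℝ) (ℓ : Yhat → Y → ℝ) (hℓ : Measurable (Function.uncurry ℓ))
    (hℓB : ∀ yhat y, ℓ yhat y ∈ Set.Icc 0 B)
    (n N : ℕ) (hn : 1 ≤ n) (hN : 1 ≤ N)
    (α : ℝ) (hα : α ∈ Set.Ioo (0 : ℝ) 1)
    (q : ℕ) (hq : q = 1 ∨ q = 2)
    (γ : ℝ) (hγ : 2 * B / (n : ℝ) ^ (1 / (q : ℝ)) ≤ γ)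
    (T : ComparisonProcedure X Y Yhat N) (hT : T.IsBlackBoxTest)
    (hvalid : ∀ (A₀ A₁ : Algorithm X Y Yhat) (P : Measure (X × Y)), IsProbabilityMeasure P →
      stability ℓ q A₀ P n ≤ γ → stability ℓ q A₁ P n ≤ γ →
      algDelta (lossDifference ℓ) P n A₀ A₁ ≤ 0 →
      T.rejectionProb A₀ A₁ P ≤ α)
    (A₀ A₁ : Algorithm X Y Yhat) (P : Measure (X × Y)) [IsProbabilityMeasure P]
    (hA₀ : stability ℓ q A₀ P n ≤ γ) (hA₁ : stability ℓ q A₁ P n ≤ γ)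
    (hΔ : 0 < algDelta (lossDifference ℓ) P n A₀ A₁)
    (hmax : B * (α⁻¹ - 1) / N < deltaMax (lossDifference ℓ) P) :
    T.rejectionProb A₀ A₁ P ≤
      min (α * (1 + (algDelta (lossDifference ℓ) P n A₀ A₁ + B * (α⁻¹ - 1) / N) /
        (deltaMax (lossDifference ℓ) P - B * (α⁻¹ - 1) / N)) ^ ((N : ℝ) / (n : ℝ))) 1 := by
  have hrej1 : T.rejectionProb A₀ A₁ P ≤ 1 := measureReal_le_one
  refine le_min ?_ hrej1
  rcases le_or_gt 1 (α * (1 + (algDelta (lossDifference ℓ) P n A₀ A₁ + B * (α⁻¹ - 1) / N) /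
        (deltaMax (lossDifference ℓ) P - B * (α⁻¹ - 1) / N)) ^ ((N : ℝ) / (n : ℝ))) with hge | hlt
  · exact hrej1.trans hge
  have hB : 0 < B := hΔ.trans_le
    ((le_abs_self _).trans (abs_integral_le_of_abs_le fun ω => abs_modelDelta_le hℓB P _ _))
  obtain ⟨a, ha0, ha1, hneg, hpow⟩ := exists_weight hB hΔ hα.1 hα.2 hn hN hmax hlt
  rw [hpow, le_div_iff₀ (by positivity), mul_comm]
  have hε : 0 < B * (α⁻¹ - 1) / N :=
    div_pos (mul_pos hB (sub_pos.2 ((one_lt_inv₀ hα.1).2 hα.2))) (by exact_mod_cast hN)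
  set M := deltaMax (lossDifference ℓ) P with hM_def
  -- The supremum need not be attained; the strict inequality leaves room for some d below M.
  have hev : ∀ᶠ d in 𝓝[<] M, 0 < d ∧
      a * (a ^ n * algDelta (lossDifference ℓ) P n A₀ A₁ - (1 - a ^ n) * d) + (1 - a) * B < 0 := by
    have hc : ContinuousAt (fun d : ℝ => a * (a ^ n * algDelta (lossDifference ℓ) P n A₀ A₁ -
        (1 - a ^ n) * d) + (1 - a) * B) M := by fun_prop
    exact ((eventually_gt_nhds (hε.trans hmax)).and (hc.eventually_lt_const hneg)).filter_mono
      nhdsWithin_le_nhds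
  obtain ⟨d, ⟨hd0, hd⟩, hdM⟩ := (hev.and self_mem_nhdsWithin).exists
  -- Without measurable models the supremum would take its default value 0, against M > ε > 0.
  have hne : {d : ℝ | ∃ f₀ f₁ : X → Yhat, Measurable f₀ ∧ Measurable f₁ ∧
      d = modelDelta (lossDifference ℓ) P f₀ f₁}.Nonempty := by
    rw [Set.nonempty_iff_ne_empty]
    intro h
    rw [deltaMax, h, Real.sSup_empty] at hM_def
    linarith
  obtain ⟨_, ⟨f₀, f₁, h₀, h₁, rfl⟩, hdf⟩ := exists_lt_of_lt_csSup hne hdM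
  have : Infinite (X × Y) := by
    obtain ⟨x, y⟩ := nonempty_of_isProbabilityMeasure P
    rcases hXY with h | h
    · have : Nonempty Y := ⟨y⟩
      infer_instance
    · have : Nonempty X := ⟨x⟩
      infer_instance
  let z : ℕ ↪ X × Y := Infinite.natEmbedding (X × Y)
  lift a to ℝ≥0 using ha0.le
  have ha1' : a ≤ 1 := by exact_mod_cast ha1.le
  have hpz := tendsto_measureReal_singleton P z.injective
  have hrisk : ∀ᶠ k in atTop, a * (a ^ n * (algDelta (lossDifference ℓ) P n A₀ A₁ +
      n * P.real {z k} * B) - (1 - a ^ n) * d) + (1 - a) * B < 0 := by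
    have hc : Tendsto (fun k => a * (a ^ n * (algDelta (lossDifference ℓ) P n A₀ A₁ +
      n * P.real {z k} * B) - (1 - a ^ n) * d) + (1 - a) * B) atTop
      (𝓝 (a * (a ^ n * (algDelta (lossDifference ℓ) P n A₀ A₁ +
      n * 0 * B) - (1 - a ^ n) * d) + (1 - a) * B)) :=
      ((((((hpz.const_mul (n : ℝ)).mul_const B).const_add _).const_mul _).sub_const _).const_mul
        _).add_const _
    refine hc.eventually_lt_const ?_
    simpa using hd
  have hatom : ∀ᶠ k in atTop, P.real {z k} ≤ (1 - a) ^ 2 :=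
    hpz.eventually_le_const (pow_pos (sub_pos.2 ha1) 2)
  -- With a fixed, the bound by α holds for all large k and passes to the limit.
  refine le_of_tendsto
    ((T.tendsto_rejectionProb_trigger A₀ A₁ h₁ h₀ hT P z.injective).const_mul ((a : ℝ) ^ N)) ?_
  have hq1 : 1 ≤ q := by omega
  filter_upwards [hrisk, hatom] with k hk hak
  refine (T.pow_mul_rejectionProb_le _ _ ha1' P (z k)).trans (hvalid _ _ _
    (isProbabilityMeasure_contaminate ha1' P (z k))
    (stability_trigger_le hℓ hℓB hB.le hq1 hn hγ ha1' P (z k) hak hA₀ h₁)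
    (stability_trigger_le hℓ hℓB hB.le hq1 hn hγ ha1' P (z k) hak hA₁ h₀) ?_)
  refine (algDelta_trigger_le hℓ hℓB ha1' P n (z k) A₀ A₁ h₀ h₁ (hd0.trans hdf).le).trans
    (le_trans ?_ hk.le)
  have han : (0 : ℝ) ≤ 1 - (a : ℝ) ^ n := sub_nonneg.2 (pow_le_one₀ a.2 ha1.le)
  gcongr
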